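/- **Theorem 4** (upper scaling law of the average STAB sum rate $\bar R_\Sigma$ for a UPA). *Model.* A satellite at altitude $H$ carries an $M_x\times M_y$ uniform planar array with $M=M_xM_y$ antennas and $M_x=M_y=M^{1/2}$. It serves $K$ users. The positions $(x_k,y_k)$ are i.i.d. uniform on $[-R,R]^2$, and the normalized Doppler frequencies $\omega_k$ are i.i.d. uniform on $[-\tfrac12,\tfrac12]$ and independent of the positions. Put $\mathbf a(x;m)=\frac1{\sqrt m}[1,e^{j2\pi x},\dots,e^{j2\pi(m-1)x}]^{\mathsf T}$, $u_{x,k}=\frac{x_k}{2H}$, $u_{y,k}=\frac{y_k}{2H}$, $\mathbf a_k=\mathbf a(u_{y,k};M_y)\otimes\mathbf a(u_{x,k};M_x)$ and $\mathbf b_k=\mathbf a(\omega_k;L)$, where $L$ is the number of snapshots. Let $\bar{\mathbf H}$ be the $ML\times K$ matrix with columns $\bar{\mathbf h}_k=\sqrt{ML}\,(\mathbf b_k\otimes\mathbf a_k)$, and let $\bar{\mathbf G}=\frac1{ML}\bar{\mathbf H}^{\mathsf H}\bar{\mathbf H}$. With space-time adaptive beamforming (STAB) and zero forcing at transmit SNR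 $\rho>0$, the average sum rate is $$\mathbb E[\bar R_\Sigma]=\frac KL\,\mathbb E\left[\log_2\left(1+\frac{\rho ML}{\operatorname{tr}(\bar{\mathbf G}^{-1})}\right)\right],$$ where the expectation is over positions and Doppler frequencies, and the SINR is $0$ if $\bar{\mathbf G}$ is singular. *Statement.* Fix $\rho>0$, $0\le p\le1$, $q\ge0$ and $0\le r<\tfrac12$. Let $M\to\infty$ through perfect squares, with $K=M^p$ and $L=M^q$ (up to rounding to integers: $K/M^p\to1$, $L/M^q\to1$) and $R/H=M^{-r}$. Put $\delta_{\mathrm{UPA}}=p+2r-1$. Then $\mathbb E[\bar R_\Sigma]$ is well defined for all large $M$, and: (i) (sparse/critical regime) if $q\ge\delta_{\mathrm{UPA}}$, then $\mathbb E[\bar R_\Sigma]=O\left(M^{p-q}\log M\right)$; (ii) (dense regime) if $q<\delta_{\mathrm{UPA}}$, then $\mathbb E[\bar R_\Sigma]\to0$. -/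

import Mathlib

open Filter Topology MeasureTheory ProbabilityTheory Asymptotics
open scoped Matrix

namespace STAB

noncomputable section

/-- The response vector `(1/√m) [1, e^{2πix}, …, e^{2πi(m-1)x}]ᵀ` of length `m` at normalized
frequency `x`. It serves both as spatial and as temporal (Doppler) steering vector. -/
def steering (m : ℕ) (x : ℝ) : Fin m → ℂ :=
  fun i => ((1 / Real.sqrt m : ℝ) : ℂ) *
    Complex.exp (2 * Real.pi * Complex.I * ((i : ℕ) : ℂ) * (x : ℂ))

/-- The Kronecker product of two vectors. -/
def kron {α β : Type*} (v : α → ℂ) (w : β → ℂ) : α × β → ℂ :=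
  fun ij => v ij.1 * w ij.2

/-- The UPA steering vector `a(u_y; My) ⊗ a(u_x; Mx)`. -/
def upaSteering (Mx My : ℕ) (ux uy : ℝ) : Fin My × Fin Mx → ℂ :=
  kron (steering My uy) (steering Mx ux)

/-- The random data of one user: the horizontal coordinates `(x, y)` and the normalized residual
Doppler frequency `ω`, stored as `((x, y), ω)`. -/
abbrev User : Type := (ℝ × ℝ) × ℝ

/-- The law of one user: `(x, y)` is uniform on the square `[-R, R] × [-R, R]`, and, independently,
`ω` is uniform on `[-1/2, 1/2]`. -/
def userLaw (R : ℝ) : Measure User :=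
  (cond (volume : Measure (ℝ × ℝ)) (Set.Icc (-R) R ×ˢ Set.Icc (-R) R)).prod
    (cond (volume : Measure ℝ) (Set.Icc (-(1 / 2)) (1 / 2)))

/-- The joint law of `K` i.i.d. users. -/
def usersLaw (K : ℕ) (R : ℝ) : Measure (Fin K → User) :=
  Measure.pi fun _ => userLaw R

/-- The stacked space-time channel vector `√(M L) (b ⊗ a)` of a user, `M = Mx My`, with unit path
gain and small-angle spatial frequencies `u_x = x / (2H)`, `u_y = y / (2H)`. -/
def channelVec (Mx My L : ℕ) (H : ℝ) (w : User) : Fin L × (Fin My × Fin Mx) → ℂ :=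
  fun i => ((Real.sqrt ((Mx * My : ℕ) * (L : ℝ)) : ℝ) : ℂ) *
    kron (steering L w.2) (upaSteering Mx My (w.1.1 / (2 * H)) (w.1.2 / (2 * H))) i

/-- The space-time channel matrix, whose columns are the stacked channel vectors. -/
def channelMatrix (Mx My L K : ℕ) (H : ℝ) (w : Fin K → User) :
    Matrix (Fin L × (Fin My × Fin Mx)) (Fin K) ℂ :=
  Matrix.of fun i k => channelVec Mx My L H (w k) i

/-- The space-time channel Gram matrix `(1/(M L)) H̄ᴴ H̄`. -/
def gram (Mx My L K : ℕ) (H : ℝ) (w : Fin K → User) : Matrix (Fin K) (Fin K) ℂ :=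
  (1 / ((((Mx * My : ℕ) : ℝ) * (L : ℝ) : ℝ) : ℂ)) •
    ((channelMatrix Mx My L K H w)ᴴ * channelMatrix Mx My L K H w)

/-- The common zero-forcing SINR `ρ M L / tr(Ḡ⁻¹)` of the users. The trace is real, the Gram matrix
being Hermitian. For a singular Gram matrix (where zero forcing does not exist and `tr(Ḡ⁻¹)` stands
for `+∞`) the value is `0`, since then `Ḡ⁻¹ = 0` and `a / 0 = 0`. -/
def sinr (ρ : ℝ) (Mx My L K : ℕ) (H : ℝ) (w : Fin K → User) : ℝ :=
  ρ * ((Mx * My : ℕ) : ℝ) * (L : ℝ) / (Matrix.trace (gram Mx My L K H w)⁻¹).re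

/-- The STAB sum rate `(K/L) log₂(1 + SINR)`. -/
def sumRate (ρ : ℝ) (Mx My L K : ℕ) (H : ℝ) (w : Fin K → User) : ℝ :=
  (K : ℝ) / (L : ℝ) * Real.logb 2 (1 + sinr ρ Mx My L K H w)

/-- The average STAB sum rate: expectation over the user locations and Doppler frequencies. -/
def avgSumRate (ρ : ℝ) (Mx My L K : ℕ) (R H : ℝ) : ℝ :=
  ∫ w, sumRate ρ Mx My L K H w ∂(usersLaw K R)

end

end STAB

/-! Zero forcing is limited by any nearly dependent combination of the users' channels. If `V` is
the channel matrix, then the SINR is `ρ / tr((Vᴴ V)⁻¹)`, and `1 / tr((Vᴴ V)⁻¹) ≤ ‖V c‖² / ‖c‖²` for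
every `c ≠ 0` (`sinr_le_of_mulVec`). Both regimes come from a choice of `c`.

For (i), a coordinate vector gives SINR at most `ρ L M`, so the rate is at most `(K/L) log₂(1 + ρ L
M)`.

For (ii), the spatial phases are at most `π √M R/H = π M^(1/2 - r)`. Truncating the exponentials
after `d ≈ 32 M^(1/2 - r)` Taylor terms in each direction leaves an error of order `2^(-d)` and a
matrix of rank at most `L d²`, of order `M^(q + 1 - 2r)`. In the dense regime `K ≈ M^p` exceeds this
rank, so the truncated matrix kills some `c ≠ 0` and the SINR is exponentially small in `d`
(`sinr_le_of_card_lt`). This beats all polynomial factors. Both bounds are deterministic once the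
positions lie in the square, which holds almost surely. -/

namespace STAB

/-! ### Zero-forcing SINR and combinations of channel vectors -/

/-- If `Vᴴ V` is invertible then the trace of its inverse is at least `‖c‖² / ‖V c‖²`. -/
theorem sum_norm_sq_le_trace_inv_mul {m n : Type*} [Fintype m] [Fintype n] [DecidableEq n]
    (V : Matrix m n ℂ) (hV : IsUnit (Vᴴ * V).det) (c : n → ℂ) :
    ∑ k, ‖c k‖ ^ 2 ≤ (Matrix.trace (Vᴴ * V)⁻¹).re * ∑ i, ‖(V *ᵥ c) i‖ ^ 2 := by
  set G := Vᴴ * V with hG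
  -- The columns of `W` are dual to those of `V`, and their squared norms sum to `tr G⁻¹`.
  -- Cauchy–Schwarz on `c k = ⟨W k, V c⟩` then gives the bound.
  set W := V * G⁻¹ with hW
  have hGH : Gᴴ = G := by simp [hG]
  have hWV : Wᴴ * V = 1 := by
    rw [hW, Matrix.conjTranspose_mul, Matrix.conjTranspose_nonsing_inv, hGH, Matrix.mul_assoc,
      ← hG, Matrix.nonsing_inv_mul _ hV]
  have hWW : Wᴴ * W = G⁻¹ := by
    rw [hW, ← Matrix.mul_assoc, ← hW, hWV, Matrix.one_mul]
  have htr : (Matrix.trace G⁻¹).re = ∑ k, ∑ i, ‖W i k‖ ^ 2 := by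
    rw [← hWW, Matrix.trace, Complex.re_sum]
    refine Finset.sum_congr rfl fun k _ => ?_
    rw [Matrix.diag_apply, Matrix.mul_apply, Complex.re_sum]
    refine Finset.sum_congr rfl fun i _ => ?_
    rw [Matrix.conjTranspose_apply, Complex.star_def, mul_comm, Complex.mul_conj,
      Complex.ofReal_re, Complex.normSq_eq_norm_sq]
  rw [htr, Finset.sum_mul]
  refine Finset.sum_le_sum fun k _ => ?_
  have hc : c k = ∑ i, star (W i k) * (V *ᵥ c) i := by
    have h : c = Wᴴ *ᵥ (V *ᵥ c) := by rw [Matrix.mulVec_mulVec, hWV, Matrix.one_mulVec]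
    exact congrFun h k
  calc ‖c k‖ ^ 2 ≤ (∑ i, ‖W i k‖ * ‖(V *ᵥ c) i‖) ^ 2 := by
        gcongr
        rw [hc]
        refine (norm_sum_le _ _).trans_eq ?_
        simp
    _ ≤ _ := Finset.sum_mul_sq_le_sq_mul_sq _ _ _

/-- The entries of the channel matrix are pure phases. -/
theorem channelMatrix_apply {N L K : ℕ} (hN : 0 < N) (hL : 0 < L) (H : ℝ) (w : Fin K → User)
    (l : Fin L) (iy ix : Fin N) (k : Fin K) :
    channelMatrix N N L K H w (l, (iy, ix)) k =
      Complex.exp (((2 * Real.pi * (l : ℕ) * (w k).2 : ℝ) : ℂ) * Complex.I) *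
      (Complex.exp (((2 * Real.pi * (iy : ℕ) * ((w k).1.2 / (2 * H)) : ℝ) : ℂ) * Complex.I) *
       Complex.exp (((2 * Real.pi * (ix : ℕ) * ((w k).1.1 / (2 * H)) : ℝ) : ℂ) * Complex.I)) := by
  have hN' : (0 : ℝ) < N := by exact_mod_cast hN
  have hL' : (0 : ℝ) < L := by exact_mod_cast hL
  have hs : Real.sqrt ((N * N : ℕ) * (L : ℝ)) *
      ((1 / Real.sqrt L) * ((1 / Real.sqrt N) * (1 / Real.sqrt N))) = 1 := by
    have h1 : Real.sqrt ((N * N : ℕ) * (L : ℝ)) = N * Real.sqrt L := by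
      rw [Real.sqrt_mul (by positivity)]
      push_cast
      rw [Real.sqrt_mul_self hN'.le]
    have h2 : Real.sqrt L ≠ 0 := (Real.sqrt_pos.2 hL').ne'
    have h3 : Real.sqrt N * Real.sqrt N = N := Real.mul_self_sqrt hN'.le
    have h4 : Real.sqrt N ≠ 0 := (Real.sqrt_pos.2 hN').ne'
    rw [h1]
    field_simp
    rw [pow_two, h3]
  have hs' := congrArg (fun t : ℝ => (t : ℂ)) hs
  simp only [Complex.ofReal_mul, Complex.ofReal_one] at hs'
  simp only [channelMatrix, channelVec, kron, upaSteering, steering, Matrix.of_apply]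
  rw [← one_mul (Complex.exp (((2 * Real.pi * (l : ℕ) * (w k).2 : ℝ) : ℂ) * Complex.I) * _), ← hs']
  have e : ∀ (j : ℕ) (x : ℝ), 2 * (Real.pi : ℂ) * Complex.I * (j : ℂ) * (x : ℂ) =
      ((2 * Real.pi * j * x : ℝ) : ℂ) * Complex.I := by
    intro j x; push_cast; ring
  rw [e, e, e]
  ring

theorem norm_channelMatrix {N L K : ℕ} (hN : 0 < N) (hL : 0 < L) (H : ℝ) (w : Fin K → User)
    (i : Fin L × (Fin N × Fin N)) (k : Fin K) : ‖channelMatrix N N L K H w i k‖ = 1 := by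
  obtain ⟨l, iy, ix⟩ := i
  rw [channelMatrix_apply hN hL]
  simp only [norm_mul, Complex.norm_exp_ofReal_mul_I, mul_one]

/-- The factor `M L` in the SINR cancels the normalization of the Gram matrix. In the singular case
both inverses are `0`. -/
theorem sinr_eq {N L K : ℕ} (hN : 0 < N) (hL : 0 < L) (ρ H : ℝ) (w : Fin K → User) :
    sinr ρ N N L K H w = ρ /
      (Matrix.trace ((channelMatrix N N L K H w)ᴴ * channelMatrix N N L K H w)⁻¹).re := by
  set A := (channelMatrix N N L K H w)ᴴ * channelMatrix N N L K H w with hA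
  set s : ℝ := ((N * N : ℕ) : ℝ) * (L : ℝ) with hs
  have hs0 : s ≠ 0 := by positivity
  have hinv : (gram N N L K H w)⁻¹ = (s : ℂ) • A⁻¹ := by
    have h0 : (1 / (s : ℂ)) ≠ 0 := by simpa using hs0
    have h1 : gram N N L K H w = (Units.mk0 (1 / (s : ℂ)) h0) • A := rfl
    by_cases hdet : IsUnit A.det
    · rw [h1, Matrix.inv_smul' _ _ hdet, Units.smul_def]
      simp
    · have hdet' : ¬ IsUnit (gram N N L K H w).det := by
        rw [h1, Units.smul_def, Matrix.det_smul, isUnit_iff_ne_zero, not_not]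
        rw [isUnit_iff_ne_zero, not_not] at hdet
        rw [hdet, mul_zero]
      rw [Matrix.nonsing_inv_apply_not_isUnit _ hdet, Matrix.nonsing_inv_apply_not_isUnit _ hdet',
        smul_zero]
  rw [sinr, hinv, Matrix.trace_smul, smul_eq_mul, Complex.re_ofReal_mul, mul_assoc, ← hs,
    mul_comm ρ s, mul_div_mul_left _ _ hs0]

open scoped ComplexOrder in
theorem trace_inv_conjTranspose_mul_self_nonneg {m n : Type*} [Fintype m] [Fintype n]
    [DecidableEq n] (V : Matrix m n ℂ) : 0 ≤ (Matrix.trace (Vᴴ * V)⁻¹).re :=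
  (Complex.le_def.1 (Matrix.posSemidef_conjTranspose_mul_self V).inv.trace_nonneg).1

theorem sinr_nonneg {N L K : ℕ} (hN : 0 < N) (hL : 0 < L) {ρ : ℝ} (hρ : 0 ≤ ρ) (H : ℝ)
    (w : Fin K → User) : 0 ≤ sinr ρ N N L K H w := by
  rw [sinr_eq hN hL]
  exact div_nonneg hρ (trace_inv_conjTranspose_mul_self_nonneg _)

/-- Any nonzero combination of the channel vectors bounds the zero-forcing SINR. -/
theorem sinr_le_of_mulVec {N L K : ℕ} (hN : 0 < N) (hL : 0 < L) {ρ : ℝ} (hρ : 0 ≤ ρ) (H : ℝ)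
    (w : Fin K → User) {c : Fin K → ℂ} (hc : c ≠ 0) {B : ℝ} (hB0 : 0 ≤ B)
    (hB : ∑ i, ‖(channelMatrix N N L K H w *ᵥ c) i‖ ^ 2 ≤ B * ∑ k, ‖c k‖ ^ 2) :
    sinr ρ N N L K H w ≤ ρ * B := by
  rw [sinr_eq hN hL]
  set V := channelMatrix N N L K H w
  by_cases hV : IsUnit (Vᴴ * V).det
  · have hS : 0 < ∑ k, ‖c k‖ ^ 2 := by
      obtain ⟨k, hk⟩ := Function.ne_iff.1 hc
      exact Finset.sum_pos' (fun _ _ => by positivity)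
        ⟨k, Finset.mem_univ _, by have := norm_pos_iff.2 hk; positivity⟩
    have h := sum_norm_sq_le_trace_inv_mul V hV c
    have hT : 0 ≤ (Matrix.trace (Vᴴ * V)⁻¹).re :=
      trace_inv_conjTranspose_mul_self_nonneg V
    set T := (Matrix.trace (Vᴴ * V)⁻¹).re
    have h1 : 1 ≤ T * B := by
      have : 1 * ∑ k, ‖c k‖ ^ 2 ≤ T * B * ∑ k, ‖c k‖ ^ 2 := by
        rw [one_mul, mul_assoc]
        exact h.trans (mul_le_mul_of_nonneg_left hB hT)
      exact le_of_mul_le_mul_right this hS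
    have hT' : 0 < T := lt_of_le_of_ne hT (by rintro h0; rw [← h0] at h1; norm_num at h1)
    rw [div_le_iff₀ hT', mul_assoc, mul_comm B]
    exact le_mul_of_one_le_right hρ h1
  · rw [Matrix.nonsing_inv_apply_not_isUnit _ hV]
    simp only [Matrix.trace_zero, Complex.zero_re, div_zero]
    positivity

theorem sinr_le {N L K : ℕ} (hN : 0 < N) (hL : 0 < L) (hK : 0 < K) {ρ : ℝ} (hρ : 0 ≤ ρ) (H : ℝ)
    (w : Fin K → User) : sinr ρ N N L K H w ≤ ρ * (L * (N : ℝ) ^ 2) := by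
  classical
  refine sinr_le_of_mulVec hN hL hρ H w (c := Pi.single ⟨0, hK⟩ 1) (by simp) (by positivity) ?_
  simp only [Matrix.mulVec_single_one, Matrix.col_apply, norm_channelMatrix hN hL]
  rw [Finset.sum_eq_single (⟨0, hK⟩ : Fin K) (by intro b _ hb; simp [hb]) (by simp)]
  simp [Fintype.card_prod, pow_two]

/-! ### Measurability -/

theorem measurable_matrix_det {α n : Type*} [MeasurableSpace α] [Fintype n] [DecidableEq n]
    {A : α → Matrix n n ℂ} (hA : ∀ i j, Measurable fun x => A x i j) :
    Measurable fun x => (A x).det := by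
  simp only [Matrix.det_apply]
  fun_prop

theorem measurable_matrix_inv {α n : Type*} [MeasurableSpace α] [Fintype n] [DecidableEq n]
    {A : α → Matrix n n ℂ} (hA : ∀ i j, Measurable fun x => A x i j) (i j : n) :
    Measurable fun x => (A x)⁻¹ i j := by
  simp only [Matrix.inv_def, Ring.inverse_eq_inv', Matrix.smul_apply, Matrix.adjugate_apply,
    smul_eq_mul]
  refine (measurable_matrix_det hA).inv.mul (measurable_matrix_det fun a b => ?_)
  simp only [Matrix.updateRow_apply]
  split_ifs
  · exact measurable_const
  · exact hA a b

theorem measurable_sumRate (ρ : ℝ) (Mx My L K : ℕ) (H : ℝ) :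
    Measurable (sumRate ρ Mx My L K H) := by
  have hch : ∀ i k, Measurable fun w : Fin K → User => channelMatrix Mx My L K H w i k := by
    intro i k
    simp only [channelMatrix, channelVec, kron, upaSteering, steering, Matrix.of_apply]
    fun_prop
  have hg : ∀ i k, Measurable fun w : Fin K → User => gram Mx My L K H w i k := by
    intro i k
    simp only [gram, Matrix.smul_apply, Matrix.mul_apply, Matrix.conjTranspose_apply, smul_eq_mul,
      Complex.star_def]
    refine Measurable.const_mul (Finset.measurable_sum _ fun j _ => ?_) _
    exact (Complex.continuous_conj.measurable.comp (hch j i)).mul (hch j k)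
  have ht : Measurable fun w : Fin K → User => Matrix.trace (gram Mx My L K H w)⁻¹ := by
    simp only [Matrix.trace, Matrix.diag_apply]
    exact Finset.measurable_sum _ fun j _ => measurable_matrix_inv hg j j
  have hs : Measurable (sinr ρ Mx My L K H) :=
    Measurable.const_div (Complex.measurable_re.comp ht) _
  unfold sumRate
  simp only [Real.logb]
  exact ((Real.measurable_log.comp (hs.const_add 1)).div_const _).const_mul _

/-! ### The law of the users -/

theorem isProbabilityMeasure_userLaw {R : ℝ} (hR : 0 < R) : IsProbabilityMeasure (userLaw R) := by
  have h1 : IsProbabilityMeasure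
      (cond (volume : Measure (ℝ × ℝ)) (Set.Icc (-R) R ×ˢ Set.Icc (-R) R)) := by
    refine cond_isProbabilityMeasure_of_finite ?_ ?_ <;>
      rw [Measure.volume_eq_prod, Measure.prod_prod, Real.volume_Icc]
    · have : 0 < ENNReal.ofReal (R - -R) := ENNReal.ofReal_pos.2 (by linarith)
      exact mul_ne_zero this.ne' this.ne'
    · exact ENNReal.mul_ne_top ENNReal.ofReal_ne_top ENNReal.ofReal_ne_top
  have h2 : IsProbabilityMeasure (cond (volume : Measure ℝ) (Set.Icc (-(1 / 2)) (1 / 2))) := by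
    refine cond_isProbabilityMeasure_of_finite ?_ ?_ <;> rw [Real.volume_Icc]
    · exact (ENNReal.ofReal_pos.2 (by norm_num)).ne'
    · exact ENNReal.ofReal_ne_top
  unfold userLaw
  infer_instance

theorem isProbabilityMeasure_usersLaw (K : ℕ) {R : ℝ} (hR : 0 < R) :
    IsProbabilityMeasure (usersLaw K R) := by
  have := isProbabilityMeasure_userLaw hR
  unfold usersLaw
  infer_instance

theorem ae_usersLaw_mem (K : ℕ) {R : ℝ} (hR : 0 < R) :
    ∀ᵐ w ∂usersLaw K R, ∀ k, |(w k).1.1| ≤ R ∧ |(w k).1.2| ≤ R := by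
  have := isProbabilityMeasure_userLaw hR
  have h : ∀ᵐ u ∂userLaw R, |u.1.1| ≤ R ∧ |u.1.2| ≤ R := by
    have h0 : ∀ᵐ z ∂(cond (volume : Measure (ℝ × ℝ)) (Set.Icc (-R) R ×ˢ Set.Icc (-R) R)),
        z ∈ Set.Icc (-R) R ×ˢ Set.Icc (-R) R :=
      ae_cond_mem (measurableSet_Icc.prod measurableSet_Icc)
    filter_upwards [Measure.quasiMeasurePreserving_fst.ae h0] with u hu
    exact ⟨abs_le.2 hu.1, abs_le.2 hu.2⟩
  rw [ae_all_iff]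
  intro k
  exact (Measure.quasiMeasurePreserving_eval (fun _ : Fin K => userLaw R) k).ae h

/-! ### Low-rank approximation of the channel matrix -/

theorem exists_ne_zero_mulVec_eq_zero {m n : Type*} [Fintype m] [Fintype n]
    (A : Matrix m n ℂ) (h : Fintype.card m < Fintype.card n) : ∃ c : n → ℂ, c ≠ 0 ∧ A *ᵥ c = 0 := by
  classical
  have hk : LinearMap.ker A.mulVecLin ≠ ⊥ := LinearMap.ker_ne_bot_of_finrank_lt (by simpa using h)
  obtain ⟨c, hc, hc0⟩ := (Submodule.ne_bot_iff _).1 hk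
  exact ⟨c, hc0, by simpa using hc⟩

/-- The remainder is at most `2 ‖z‖^d / d!`, while `(8‖z‖)^d / d! ≤ exp (8‖z‖) ≤ e^d ≤ 4^d`;
dividing by `8^d` leaves `(1/2)^d`. -/
theorem norm_exp_sub_taylor_le {z : ℂ} {d : ℕ} (h : 8 * ‖z‖ ≤ d) :
    ‖Complex.exp z - ∑ m ∈ Finset.range d, z ^ m / (m.factorial : ℂ)‖ ≤ 2 * (1 / 2) ^ d := by
  have hz := norm_nonneg z
  have h1 : ‖z‖ / (d.succ : ℝ) ≤ 1 / 2 := by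
    rw [div_le_iff₀ (by positivity)]
    push_cast
    linarith
  refine (Complex.exp_bound' h1).trans ?_
  rw [mul_comm]
  gcongr
  have h2 := Real.pow_div_factorial_le_exp (8 * ‖z‖) (by positivity) d
  have h3 : Real.exp (8 * ‖z‖) ≤ 4 ^ d := by
    calc Real.exp (8 * ‖z‖) ≤ Real.exp d := Real.exp_le_exp.2 h
      _ = Real.exp 1 ^ d := by rw [← Real.exp_nat_mul, mul_one]
      _ ≤ 4 ^ d := by
        gcongr
        linarith [Real.exp_one_lt_d9]
  rw [mul_pow, mul_div_assoc] at h2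
  have h4 : (8 : ℝ) ^ d * (‖z‖ ^ d / d.factorial) ≤ 8 ^ d * (1 / 2) ^ d := by
    rw [← mul_pow]
    norm_num
    exact h2.trans h3
  exact le_of_mul_le_mul_left h4 (by positivity)

/-- If the number of users exceeds `L d²`, where `d` is large compared with the phase range
of the users over the array, the zero-forcing SINR is exponentially small in `d`. -/
theorem sinr_le_of_card_lt {N L K d : ℕ} (hN : 0 < N) (hL : 0 < L) (hd : L * (d * d) < K)
    {ρ H R : ℝ} (hρ : 0 ≤ ρ) (hH : 0 < H) (hRd : 8 * (Real.pi * N * (R / H)) ≤ d)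
    (w : Fin K → User) (hw : ∀ k, |(w k).1.1| ≤ R ∧ |(w k).1.2| ≤ R) :
    sinr ρ N N L K H w ≤ ρ * (64 * L * (N : ℝ) ^ 2 * K * (1 / 4) ^ d) := by
  set e : ℕ → ℝ → ℂ := fun j u => Complex.exp (((2 * Real.pi * j * u : ℝ) : ℂ) * Complex.I) with he
  set T : ℕ → ℝ → ℂ := fun j u =>
    ∑ m ∈ Finset.range d, (((2 * Real.pi * j * u : ℝ) : ℂ) * Complex.I) ^ m / (m.factorial : ℂ)
    with hT
  set t : ℝ → ℕ → ℂ := fun u m =>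
    (((2 * Real.pi * u : ℝ) : ℂ) * Complex.I) ^ m / (m.factorial : ℂ) with ht
  -- The truncation separates the antenna index `j` from the user's frequency `u`, which is what
  -- bounds the rank.
  have hTt : ∀ j u, T j u = ∑ a : Fin d, (j : ℂ) ^ (a : ℕ) * t u a := by
    intro j u
    rw [hT, ht]
    simp only
    rw [Finset.sum_range]
    refine Finset.sum_congr rfl fun a _ => ?_
    rw [← mul_div_assoc, ← mul_pow]
    congr 2
    push_cast
    ring
  -- The Doppler factor is kept exact, costing `L` rows; the two spatial factors cost `d` rows each.
  obtain ⟨c, hc0, hc⟩ := exists_ne_zero_mulVec_eq_zero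
    (Matrix.of fun (i : Fin L × (Fin d × Fin d)) (k : Fin K) =>
      e i.1 (w k).2 * (t ((w k).1.2 / (2 * H)) i.2.1 * t ((w k).1.1 / (2 * H)) i.2.2))
    (by simpa [Fintype.card_prod] using hd)
  set ε : ℝ := 2 * (1 / 2) ^ d with hε
  have hε0 : 0 ≤ ε := by positivity
  have hε2 : ε ≤ 2 := by
    have : ((1 : ℝ) / 2) ^ d ≤ 1 := pow_le_one₀ (by norm_num) (by norm_num)
    linarith
  have hen : ∀ j u, ‖e j u‖ = 1 := fun j u => Complex.norm_exp_ofReal_mul_I _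
  have herr : ∀ (j : Fin N) (x : ℝ), |x| ≤ R →
      ‖e j (x / (2 * H)) - T j (x / (2 * H))‖ ≤ ε := by
    intro j x hx
    refine norm_exp_sub_taylor_le (le_trans ?_ hRd)
    rw [norm_mul, Complex.norm_I, mul_one, Complex.norm_real, Real.norm_eq_abs, abs_mul, abs_div,
      abs_of_nonneg (by positivity : 0 ≤ 2 * Real.pi * ((j : ℕ) : ℝ)),
      abs_of_pos (by positivity : 0 < 2 * H)]
    have hj : ((j : ℕ) : ℝ) ≤ N := by exact_mod_cast j.2.le
    have : 2 * Real.pi * ((j : ℕ) : ℝ) * (|x| / (2 * H)) = Real.pi * (j : ℕ) * (|x| / H) := by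
      field_simp
    rw [this]
    gcongr
  have hTn : ∀ (j : Fin N) (x : ℝ), |x| ≤ R → ‖T j (x / (2 * H))‖ ≤ 3 := by
    intro j x hx
    have h1 := norm_sub_norm_le (T j (x / (2 * H))) (e j (x / (2 * H)))
    rw [norm_sub_rev, hen] at h1
    linarith [herr j x hx]
  have hzero : ∀ (l : Fin L) (iy ix : Fin N), ∑ k, e l (w k).2 *
      (T iy ((w k).1.2 / (2 * H)) * T ix ((w k).1.1 / (2 * H))) * c k = 0 := by
    intro l iy ix
    calc _ = ∑ k, ∑ a : Fin d, ∑ b : Fin d, ((iy : ℕ) : ℂ) ^ (a : ℕ) * ((ix : ℕ) : ℂ) ^ (b : ℕ) *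
          (e l (w k).2 * (t ((w k).1.2 / (2 * H)) a * t ((w k).1.1 / (2 * H)) b) * c k) := by
          refine Finset.sum_congr rfl fun k _ => ?_
          rw [hTt, hTt, Finset.sum_mul_sum, Finset.mul_sum, Finset.sum_mul]
          refine Finset.sum_congr rfl fun a _ => ?_
          rw [Finset.mul_sum, Finset.sum_mul]
          refine Finset.sum_congr rfl fun b _ => ?_
          ring
      _ = ∑ a : Fin d, ∑ b : Fin d, ((iy : ℕ) : ℂ) ^ (a : ℕ) * ((ix : ℕ) : ℂ) ^ (b : ℕ) *
          ∑ k, (e l (w k).2 * (t ((w k).1.2 / (2 * H)) a * t ((w k).1.1 / (2 * H)) b) * c k) := by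
          rw [Finset.sum_comm]
          refine Finset.sum_congr rfl fun a _ => ?_
          rw [Finset.sum_comm]
          refine Finset.sum_congr rfl fun b _ => ?_
          rw [Finset.mul_sum]
      _ = 0 := by
          refine Finset.sum_eq_zero fun a _ => Finset.sum_eq_zero fun b _ => ?_
          have := congrFun hc (l, (a, b))
          simp only [Matrix.mulVec, dotProduct, Matrix.of_apply, Pi.zero_apply] at this
          rw [this, mul_zero]
  -- Here `4 = 1 + 3`, from `e e' - T T' = e (e' - T') + (e - T) T'` with `‖e‖ = 1` and `‖T'‖ ≤ 1 +
  -- ε ≤ 3`.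
  have hrow : ∀ i, ‖(channelMatrix N N L K H w *ᵥ c) i‖ ^ 2 ≤
      (4 * ε) ^ 2 * (K * ∑ k, ‖c k‖ ^ 2) := by
    rintro ⟨l, iy, ix⟩
    have h1 : (channelMatrix N N L K H w *ᵥ c) (l, (iy, ix)) = ∑ k, (e l (w k).2 *
        (e iy ((w k).1.2 / (2 * H)) * e ix ((w k).1.1 / (2 * H)) -
          T iy ((w k).1.2 / (2 * H)) * T ix ((w k).1.1 / (2 * H)))) * c k := by
      simp only [mul_sub, sub_mul, Finset.sum_sub_distrib]
      rw [hzero, sub_zero, Matrix.mulVec, dotProduct]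
      exact Finset.sum_congr rfl fun k _ => by rw [channelMatrix_apply hN hL]
    have h2 : ‖(channelMatrix N N L K H w *ᵥ c) (l, (iy, ix))‖ ≤ 4 * ε * ∑ k, ‖c k‖ := by
      rw [h1, Finset.mul_sum]
      refine (norm_sum_le _ _).trans (Finset.sum_le_sum fun k _ => ?_)
      rw [norm_mul, norm_mul, hen, one_mul]
      gcongr
      have hy := herr iy _ (hw k).2
      have hx := herr ix _ (hw k).1
      have hxT := hTn ix _ (hw k).1
      calc _ = ‖e iy ((w k).1.2 / (2 * H)) *
              (e ix ((w k).1.1 / (2 * H)) - T ix ((w k).1.1 / (2 * H))) +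
            (e iy ((w k).1.2 / (2 * H)) - T iy ((w k).1.2 / (2 * H))) *
              T ix ((w k).1.1 / (2 * H))‖ := by
            congr 1
            ring
        _ ≤ 1 * ε + ε * 3 := by
            refine (norm_add_le _ _).trans ?_
            rw [norm_mul, norm_mul, hen]
            gcongr
        _ = 4 * ε := by ring
    calc _ ≤ (4 * ε * ∑ k, ‖c k‖) ^ 2 := by gcongr
      _ = (4 * ε) ^ 2 * (∑ k, ‖c k‖) ^ 2 := by ring
      _ ≤ _ := by
        gcongr
        simpa using sq_sum_le_card_mul_sum_sq (s := Finset.univ) (f := fun k => ‖c k‖)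
  refine sinr_le_of_mulVec hN hL hρ H w hc0 (by positivity) ?_
  refine (Finset.sum_le_sum fun i _ => hrow i).trans_eq ?_
  have h4 : ((1 : ℝ) / 4) ^ d = ((1 / 2) ^ d) ^ 2 := by
    rw [← pow_mul, mul_comm, pow_mul]
    norm_num
  rw [Finset.sum_const, Finset.card_univ, h4, hε]
  simp only [Fintype.card_prod, Fintype.card_fin, nsmul_eq_mul]
  push_cast
  ring

/-! ### Bounds on the sum rate -/

theorem sumRate_nonneg {N L K : ℕ} (hN : 0 < N) (hL : 0 < L) {ρ : ℝ} (hρ : 0 ≤ ρ) (H : ℝ)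
    (w : Fin K → User) : 0 ≤ sumRate ρ N N L K H w :=
  mul_nonneg (by positivity)
    (Real.logb_nonneg (by norm_num) (by linarith [sinr_nonneg hN hL hρ H w]))

theorem sumRate_le {N L K : ℕ} (hN : 0 < N) (hL : 0 < L) (hK : 0 < K) {ρ : ℝ} (hρ : 0 ≤ ρ)
    (H : ℝ) (w : Fin K → User) :
    sumRate ρ N N L K H w ≤ K / L * Real.logb 2 (1 + ρ * (L * (N : ℝ) ^ 2)) := by
  have h0 := sinr_nonneg hN hL hρ H w
  unfold sumRate
  gcongr
  · norm_num
  · exact sinr_le hN hL hK hρ H w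

theorem sumRate_le_of_card_lt {N L K d : ℕ} (hN : 0 < N) (hL : 0 < L) (hd : L * (d * d) < K)
    {ρ H R : ℝ} (hρ : 0 ≤ ρ) (hH : 0 < H) (hRd : 8 * (Real.pi * N * (R / H)) ≤ d)
    (w : Fin K → User) (hw : ∀ k, |(w k).1.1| ≤ R ∧ |(w k).1.2| ≤ R) :
    sumRate ρ N N L K H w ≤ 128 * ρ * ((K : ℝ) ^ 2 * (N : ℝ) ^ 2 * (1 / 4) ^ d) := by
  have h0 := sinr_nonneg hN hL hρ H w
  have h1 := sinr_le_of_card_lt hN hL hd hρ hH hRd w hw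
  -- The factor `2` comes from `log (1 + x) ≤ x` and `log 2 > 1/2`.
  have hlog : Real.logb 2 (1 + sinr ρ N N L K H w) ≤ 2 * sinr ρ N N L K H w := by
    rw [Real.logb, div_le_iff₀ (Real.log_pos (by norm_num))]
    have h2 := Real.log_le_sub_one_of_pos (by linarith : 0 < 1 + sinr ρ N N L K H w)
    nlinarith [Real.log_two_gt_d9]
  have hL' : (L : ℝ) ≠ 0 := by positivity
  calc sumRate ρ N N L K H w
      ≤ K / L * (2 * (ρ * (64 * L * (N : ℝ) ^ 2 * K * (1 / 4) ^ d))) := by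
        unfold sumRate
        gcongr
        linarith
    _ = _ := by
        field_simp
        ring

theorem integrable_sumRate {N L K : ℕ} (hN : 0 < N) (hL : 0 < L) (hK : 0 < K) {ρ R : ℝ}
    (hρ : 0 ≤ ρ) (H : ℝ) (hR : 0 < R) :
    Integrable (sumRate ρ N N L K H) (usersLaw K R) := by
  have := isProbabilityMeasure_usersLaw K hR
  refine Integrable.of_bound (measurable_sumRate ρ N N L K H).aestronglyMeasurable
    (K / L * Real.logb 2 (1 + ρ * (L * (N : ℝ) ^ 2))) (ae_of_all _ fun w => ?_)
  rw [Real.norm_of_nonneg (sumRate_nonneg hN hL hρ H w)]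
  exact sumRate_le hN hL hK hρ H w

theorem avgSumRate_nonneg {N L : ℕ} (hN : 0 < N) (hL : 0 < L) (K : ℕ) {ρ : ℝ} (hρ : 0 ≤ ρ)
    (R H : ℝ) : 0 ≤ avgSumRate ρ N N L K R H :=
  integral_nonneg fun w => sumRate_nonneg hN hL hρ H w

theorem avgSumRate_le_of_ae {N L K : ℕ} (hN : 0 < N) (hL : 0 < L) {ρ R H C : ℝ}
    (hρ : 0 ≤ ρ) (hR : 0 < R) (hC : ∀ᵐ w ∂usersLaw K R, sumRate ρ N N L K H w ≤ C) :
    avgSumRate ρ N N L K R H ≤ C := by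
  have := isProbabilityMeasure_usersLaw K hR
  calc avgSumRate ρ N N L K R H ≤ ∫ _, C ∂usersLaw K R :=
        integral_mono_of_nonneg (ae_of_all _ fun w => sumRate_nonneg hN hL hρ H w)
          (integrable_const C) hC
    _ = C := by simp

/-! ### Asymptotics -/

theorem eventually_half_le_and_le_two_mul {α : Type*} {l : Filter α} {u v : α → ℝ}
    (h : u ~[l] v) (hv : ∀ᶠ n in l, 0 < v n) :
    ∀ᶠ n in l, v n / 2 ≤ u n ∧ u n ≤ 2 * v n := by
  filter_upwards [h.isLittleO.def (by norm_num : (0 : ℝ) < 1 / 2), hv] with n hn hvn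
  rw [Pi.sub_apply, Real.norm_eq_abs, Real.norm_of_nonneg hvn.le, abs_le] at hn
  constructor <;> linarith [hn.1, hn.2]

/-- With `X = M`, the logarithm is at most a constant plus `(q + 1) log X`, and `1 ≤ log X` absorbs
the constant. -/
theorem div_mul_logb_le_rpow_mul_log {ρ p q X K L : ℝ} (hρ : 0 < ρ) (hq : 0 ≤ q) (hX : 0 < X)
    (hlog : 1 ≤ Real.log X) (hK : K ≤ 2 * X ^ p) (hL : X ^ q / 2 ≤ L) (hL' : L ≤ 2 * X ^ q) :
    K / L * Real.logb 2 (1 + ρ * (L * X)) ≤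
      4 * (Real.log (1 + 2 * ρ) + q + 1) / Real.log 2 * (X ^ (p - q) * Real.log X) := by
  have hXq : 0 < X ^ q := Real.rpow_pos_of_pos hX q
  have hX1 : 1 ≤ X := by
    by_contra hlt
    linarith [Real.log_nonpos hX.le (not_le.1 hlt).le]
  have hLpos : 0 < L := lt_of_lt_of_le (by positivity) hL
  have hl2 : 0 < Real.log 2 := Real.log_pos (by norm_num)
  have h1 : K / L ≤ 4 * X ^ (p - q) := by
    rw [div_le_iff₀ hLpos, Real.rpow_sub hX]
    calc K ≤ 2 * X ^ p := hK
      _ = 4 * (X ^ p / X ^ q) * (X ^ q / 2) := by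
        field_simp
        ring
      _ ≤ _ := by gcongr
  have h2 : Real.log (1 + ρ * (L * X)) ≤ (Real.log (1 + 2 * ρ) + q + 1) * Real.log X := by
    have hpow : 1 ≤ X ^ (q + 1) := Real.one_le_rpow hX1 (by linarith)
    calc Real.log (1 + ρ * (L * X)) ≤ Real.log ((1 + 2 * ρ) * X ^ (q + 1)) := by
          refine Real.log_le_log (by positivity) ?_
          have : ρ * (L * X) ≤ ρ * (2 * X ^ q * X) := by gcongr
          rw [Real.rpow_add_one hX.ne'] at hpow ⊢
          linarith
      _ = Real.log (1 + 2 * ρ) + (q + 1) * Real.log X := by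
          rw [Real.log_mul (by positivity) (by positivity), Real.log_rpow hX]
      _ ≤ _ := by
          have : 0 ≤ Real.log (1 + 2 * ρ) := Real.log_nonneg (by linarith)
          nlinarith
  have h3 : 0 ≤ Real.log (1 + ρ * (L * X)) :=
    Real.log_nonneg (by linarith [show 0 < ρ * (L * X) by positivity])
  calc K / L * Real.logb 2 (1 + ρ * (L * X))
      ≤ 4 * X ^ (p - q) * ((Real.log (1 + 2 * ρ) + q + 1) * Real.log X / Real.log 2) := by
        rw [Real.logb]
        gcongr
    _ = _ := by ring

theorem tendsto_rpow_mul_exp_neg_rpow (a : ℝ) {s : ℝ} (hs : 0 < s) :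
    Tendsto (fun x : ℝ => x ^ a * Real.exp (-x ^ s)) atTop (𝓝 0) := by
  have h := (tendsto_rpow_mul_exp_neg_mul_atTop_nhds_zero (a / s) 1 one_pos).comp
    (tendsto_rpow_atTop hs)
  refine h.congr' ?_
  filter_upwards [eventually_ge_atTop 0] with x hx
  simp only [Function.comp_apply]
  rw [← Real.rpow_mul hx, mul_div_cancel₀ _ hs.ne', neg_one_mul]

/-- Rounding up replaces `32` by `33`, as `1 ≤ X ^ s`. Then `4356 = 4 · 33²`, each factor `2` coming
from the bounds on `K` and `L`. -/
theorem mul_ceil_sq_lt {p q s X : ℝ} {K L : ℕ} (hX : 0 < X) (hXs : 1 ≤ X ^ s)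
    (hgap : 4356 < X ^ (p - q - 2 * s)) (hK : X ^ p / 2 ≤ K) (hL : (L : ℝ) ≤ 2 * X ^ q) :
    L * (⌈32 * X ^ s⌉₊ * ⌈32 * X ^ s⌉₊) < K := by
  have hd : (⌈32 * X ^ s⌉₊ : ℝ) ≤ 33 * X ^ s := by
    linarith [(Nat.ceil_lt_add_one (by positivity : 0 ≤ 32 * X ^ s)).le]
  have hXq := Real.rpow_pos_of_pos hX q
  have hXp := Real.rpow_pos_of_pos hX p
  have hsplit : X ^ p = X ^ (p - q - 2 * s) * (X ^ q * (X ^ s * X ^ s)) := by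
    rw [← Real.rpow_add hX, ← Real.rpow_add hX, ← Real.rpow_add hX]
    congr 1
    ring
  have : (L : ℝ) * (⌈32 * X ^ s⌉₊ * ⌈32 * X ^ s⌉₊) < K := by
    calc (L : ℝ) * (⌈32 * X ^ s⌉₊ * ⌈32 * X ^ s⌉₊)
        ≤ 2 * X ^ q * (33 * X ^ s * (33 * X ^ s)) := by gcongr
      _ = 4356 * (X ^ q * (X ^ s * X ^ s)) / 2 := by ring
      _ < X ^ (p - q - 2 * s) * (X ^ q * (X ^ s * X ^ s)) / 2 := by gcongr
      _ = X ^ p / 2 := by rw [hsplit]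
      _ ≤ K := hK
  exact_mod_cast this

theorem one_div_four_pow_ceil_le (y : ℝ) (hy : 0 ≤ y) :
    (1 / 4 : ℝ) ^ ⌈32 * y⌉₊ ≤ Real.exp (-y) := by
  have h4 : (1 / 4 : ℝ) ≤ Real.exp (-1) := by
    rw [Real.exp_neg, one_div]
    exact inv_anti₀ (Real.exp_pos 1) (by linarith [Real.exp_one_lt_d9])
  calc (1 / 4 : ℝ) ^ ⌈32 * y⌉₊ ≤ Real.exp (-1) ^ ⌈32 * y⌉₊ := by gcongr
    _ = Real.exp (-(⌈32 * y⌉₊ : ℝ)) := by rw [← Real.exp_nat_mul, mul_neg_one]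
    _ ≤ Real.exp (-y) := by
      gcongr
      linarith [Nat.le_ceil (32 * y)]

end STAB

/-- The array is the `N × N` UPA, `M = N²` antennas, along an arbitrary sequence `N n → ∞`; the
integers `K n`, `L n` are `M ^ p`, `M ^ q` up to rounding (asymptotic equality). -/
theorem theorem4 (p q r ρ : ℝ) (hp₀ : 0 ≤ p) (hp₁ : p ≤ 1) (hq : 0 ≤ q)
    (hr₀ : 0 ≤ r) (hr₁ : r < 1 / 2) (hρ : 0 < ρ)
    (N K L : ℕ → ℕ) (R H : ℕ → ℝ)
    (hN : Tendsto N atTop atTop)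
    (hK : (fun n => (K n : ℝ)) ~[atTop] fun n => ((N n : ℝ) ^ 2) ^ p)
    (hL : (fun n => (L n : ℝ)) ~[atTop] fun n => ((N n : ℝ) ^ 2) ^ q)
    (hH : ∀ n, 0 < H n)
    (hR : ∀ n, R n / H n = ((N n : ℝ) ^ 2) ^ (-r)) :
    (∀ᶠ n in atTop, IsProbabilityMeasure (STAB.usersLaw (K n) (R n)) ∧
      Integrable (STAB.sumRate ρ (N n) (N n) (L n) (K n) (H n)) (STAB.usersLaw (K n) (R n))) ∧
    (p + 2 * r - 1 ≤ q →
      (fun n => STAB.avgSumRate ρ (N n) (N n) (L n) (K n) (R n) (H n)) =O[atTop]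
        fun n => ((N n : ℝ) ^ 2) ^ (p - q) * Real.log ((N n : ℝ) ^ 2)) ∧
    (q < p + 2 * r - 1 →
      Tendsto (fun n => STAB.avgSumRate ρ (N n) (N n) (L n) (K n) (R n) (H n)) atTop (𝓝 0)) := by
  have hX : Tendsto (fun n => (N n : ℝ) ^ 2) atTop atTop :=
    (tendsto_pow_atTop two_ne_zero).comp (tendsto_natCast_atTop_atTop.comp hN)
  have hNpos : ∀ᶠ n in atTop, 0 < N n := hN.eventually_gt_atTop 0
  have hpos : ∀ a : ℝ, ∀ᶠ n in atTop, 0 < ((N n : ℝ) ^ 2) ^ a := fun a => by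
    filter_upwards [hX.eventually_gt_atTop 0] with n hn using Real.rpow_pos_of_pos hn a
  have hK2 := STAB.eventually_half_le_and_le_two_mul hK (hpos p)
  have hL2 := STAB.eventually_half_le_and_le_two_mul hL (hpos q)
  have hKpos : ∀ᶠ n in atTop, 0 < K n := by
    filter_upwards [hK2, hpos p] with n hn hn0
    have : (0 : ℝ) < K n := by linarith [hn.1]
    exact_mod_cast this
  have hLpos : ∀ᶠ n in atTop, 0 < L n := by
    filter_upwards [hL2, hpos q] with n hn hn0
    have : (0 : ℝ) < L n := by linarith [hn.1]
    exact_mod_cast this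
  have hRpos : ∀ᶠ n in atTop, 0 < R n := by
    filter_upwards [hpos (-r)] with n hn
    rw [← hR n] at hn
    exact (div_pos_iff_of_pos_right (hH n)).1 hn
  refine ⟨?_, fun _ => ?_, fun hqδ => ?_⟩
  · filter_upwards [hNpos, hKpos, hLpos, hRpos] with n h1 h2 h3 h4
    exact ⟨STAB.isProbabilityMeasure_usersLaw _ h4,
      STAB.integrable_sumRate h1 h3 h2 hρ.le _ h4⟩
  · refine IsBigO.of_bound (4 * (Real.log (1 + 2 * ρ) + q + 1) / Real.log 2) ?_
    filter_upwards [hNpos, hKpos, hLpos, hRpos, hK2, hL2, hX.eventually_gt_atTop 0,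
      (Real.tendsto_log_atTop.comp hX).eventually_ge_atTop 1] with n h1 h2 h3 h4 h5 h6 h7 h8
    rw [Function.comp_apply] at h8
    rw [Real.norm_of_nonneg (STAB.avgSumRate_nonneg h1 h3 _ hρ.le _ _),
      Real.norm_of_nonneg (mul_nonneg (Real.rpow_nonneg h7.le _) (zero_le_one.trans h8))]
    refine (STAB.avgSumRate_le_of_ae h1 h3 hρ.le h4
      (ae_of_all _ fun w => STAB.sumRate_le h1 h3 h2 hρ.le _ w)).trans ?_
    exact STAB.div_mul_logb_le_rpow_mul_log hρ hq h7 h8 h5.2 h6.1 h6.2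
  · have hs : 0 < 1 / 2 - r := by linarith
    -- The majorant comes from `128 ρ K² N² (1/4)^d` with `K ≤ 2 M^p`, hence `512 = 128 · 2²` and
    -- the exponent `2p + 1`.
    have hlim : Tendsto (fun n => 512 * ρ * (((N n : ℝ) ^ 2) ^ (2 * p + 1) *
        Real.exp (-((N n : ℝ) ^ 2) ^ (1 / 2 - r)))) atTop (𝓝 0) := by
      simpa using ((STAB.tendsto_rpow_mul_exp_neg_rpow (2 * p + 1) hs).comp hX).const_mul (512 * ρ)
    refine squeeze_zero' ?_ ?_ hlim
    · filter_upwards [hNpos, hLpos] with n h1 h3 using STAB.avgSumRate_nonneg h1 h3 _ hρ.le _ _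
    -- The exponent `p - q - 2(1/2 - r)` equals `δ_UPA - q`, so it is positive exactly in the dense
    -- regime.
    filter_upwards [hNpos, hLpos, hRpos, hK2, hL2, hX.eventually_gt_atTop 0,
      ((tendsto_rpow_atTop hs).comp hX).eventually_ge_atTop 1,
      ((tendsto_rpow_atTop (by linarith : 0 < p - q - 2 * (1 / 2 - r))).comp
        hX).eventually_gt_atTop 4356] with n h1 h3 h4 h5 h6 h7 h8 h9
    simp only [Function.comp_apply] at h8 h9
    have hcard := STAB.mul_ceil_sq_lt h7 h8 h9 h5.1 h6.2
    have hphase : 8 * (Real.pi * N n * (R n / H n)) ≤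
        (⌈32 * ((N n : ℝ) ^ 2) ^ (1 / 2 - r)⌉₊ : ℝ) := by
      refine le_trans ?_ (Nat.le_ceil _)
      have hsqrt : (N n : ℝ) = ((N n : ℝ) ^ 2) ^ (1 / 2 : ℝ) := by
        rw [← Real.sqrt_eq_rpow, Real.sqrt_sq (Nat.cast_nonneg _)]
      have hprod : (N n : ℝ) * (R n / H n) = ((N n : ℝ) ^ 2) ^ (1 / 2 - r) := by
        rw [hR, sub_eq_add_neg, Real.rpow_add h7, ← hsqrt]
      rw [mul_assoc Real.pi, hprod]
      -- The constant `32` in `d` is chosen because `8π < 32`.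
      nlinarith [Real.pi_lt_four]
    refine STAB.avgSumRate_le_of_ae h1 h3 hρ.le h4 ?_
    filter_upwards [STAB.ae_usersLaw_mem (K n) h4] with w hw
    refine (STAB.sumRate_le_of_card_lt h1 h3 hcard hρ.le (hH n) hphase w hw).trans ?_
    have hsplit : ((N n : ℝ) ^ 2) ^ (2 * p + 1) =
        (((N n : ℝ) ^ 2) ^ p) ^ 2 * (N n : ℝ) ^ 2 := by
      rw [Real.rpow_add_one h7.ne', mul_comm 2 p, Real.rpow_mul h7.le, Real.rpow_two]
    calc 128 * ρ * ((K n : ℝ) ^ 2 * (N n : ℝ) ^ 2 *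
          (1 / 4) ^ ⌈32 * ((N n : ℝ) ^ 2) ^ (1 / 2 - r)⌉₊)
        ≤ 128 * ρ * ((2 * ((N n : ℝ) ^ 2) ^ p) ^ 2 * (N n : ℝ) ^ 2 *
          Real.exp (-((N n : ℝ) ^ 2) ^ (1 / 2 - r))) := by
          gcongr
          · exact h5.2
          · exact STAB.one_div_four_pow_ceil_le _ (zero_le_one.trans h8)
      _ = _ := by
          rw [hsplit]
          ring
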